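/- **Setting.** Let $k\ge 1$ and $r_1,r_2,h_1,h_2,\delta\ge 0$ be integers with $t_1r_1=k+h_1$ and $t_2r_2=r_1+h_2$ for integers $t_1,t_2$, and let $n_2=r_2+\delta\ge 2$, $n_1=t_2n_2$, $n=t_1n_1$. Index the $n$ coordinates by triples $(i,s,j)\in[t_1]\times[t_2]\times[n_2]$; let $A_i$ be the set of coordinates with first entry $i$ and $B_{i,s}\subseteq A_i$ the set of those with first two entries $i,s$. A $[k,r_1,r_2,h_1,h_2,\delta]$ *hierarchical local code* is a linear code of dimension $k$ with these coordinates that is defined by $h_1$ parity checks on all coordinates, $h_2$ parity checks on each $A_i$ and $\delta$ parity checks on each $B_{i,s}$. It is *maximally recoverable* (an HL-MRC) if for every set $E$ of $k+h_1$ coordinates with $|E\cap B_{i,s}|\le r_2$ for all $i,s$ and $|E\cap A_i|=r_1$ for all $i$, the restriction of the code to $E$ is a $[k+h_1,k,h_1+1]$ MDS code. A family of vectors is *$w$-wise independent* over $F$ if any at most $w$ of its members (at distinct indices) are linearly independent over $F$. A *BCH code* over $F$ of length $N$ with designed distance $d$ is the set of $c\in F^N$ such that $\sum_{j=0}^{N-1}c_jX^j$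 vanishes at $\gamma^b,\gamma^{b+1},\dots,\gamma^{b+d-2}$, for some $b\ge 0$ and some primitive $N$-th root of unity $\gamma$ in an extension of $F$. A parity-check matrix of a code is any matrix whose kernel is the code (its rows may be linearly dependent). A column of such a matrix with $\mu$ rows over $F$ is read as an element of the degree-$\mu$ extension of $F$ through a fixed $F$-linear isomorphism with $F^\mu$. **Construction.** Let $\mathbb F_q\subseteq\mathbb F_{q^{m_1}}\subseteq\mathbb F_{q^m}$ with $m_1\mid m$, let $\beta\in\mathbb F_q$ be a primitive element, $\alpha_{s,j}\in\mathbb F_{q^{m_1}}$ and $\lambda_{i,s,j}\in\mathbb F_{q^m}$. Let $M_0$ be the $\delta\times n_2$ Vandermonde matrix with rows the powers $0,\dots,\delta-1$ of the nodes $0,\beta,\beta^2,\dots,\beta^{n_2-1}$ (with $0^0=1$). Let $M_s$ be the $h_2\times n_2$ matrix with rows $(\alpha_{s,j}^{q^{l}})_j$, $0\le l<h_2$, and let $H_i$ be the $h_1\times n_1$ matrix with rows $(\lambda_{i,s,j}^{q^{m_1l}})_{s,j}$, $0\le l<h_1$. Let $H_0$ consist of $t_2$ diagonal copies of $M_0$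 above the row block $[M_1\cdots M_{t_2}]$, and let $H$ consist of $t_1$ diagonal copies of $H_0$ above the row block $[H_1\cdots H_{t_1}]$. Let $\mathcal C$ be the code over $\mathbb F_{q^m}$ with parity-check matrix $H$. **Theorem.** Let $q$ be the smallest prime power greater than $n_2$, let $$m_1=1+\Big\lceil\tfrac{q-1}{q}\big((\delta+1)h_2-1\big)\Big\rceil\big\lceil\log_q(n_2t_2)\big\rceil ,$$ and let $m$ be a multiple of $m_1$ with $$\frac m{m_1}\ \ge\ 1+\Big\lceil\tfrac{q^{m_1}-1}{q^{m_1}}\big((\delta+1)(h_2+1)h_1-1\big)\Big\rceil\big\lceil\log_{q^{m_1}}(n)\big\rceil ,$$ for example the smallest one, for which equality holds. Consider the following choice of parameters. 1. The $\alpha_{s,j}$ are distinct columns of a parity-check matrix with $m_1$ rows of a BCH code over $\mathbb F_q$ of length $q^{\lceil\log_q(n_2t_2)\rceil}-1$ with designed distance $(\delta+1)h_2+1$. 2. The $\lambda_{i,s,j}$ are distinct columns of a parity-check matrix with $m/m_1$ rows of a BCH code over $\mathbb F_{q^{m_1}}$ of length $q^{m_1\lceil\log_{q^{m_1}}(n)\rceil}-1$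 with designed distance $(\delta+1)(h_2+1)h_1+1$. (Here "distinct columns" means columns in distinct positions.) Such choices of $\beta$, $(\alpha_{s,j})$ and $(\lambda_{i,s,j})$ exist. For every such choice, the $\alpha_{s,j}$ are $(\delta+1)h_2$-wise independent over $\mathbb F_q$, the $\lambda_{i,s,j}$ are $(\delta+1)(h_2+1)h_1$-wise independent over $\mathbb F_{q^{m_1}}$, and $\mathcal C$ is a $[k,r_1,r_2,h_1,h_2,\delta]$ HL-MRC. -/

import Mathlib

namespace HLMRC

/-! ### Linear codes -/

/-- The minimum Hamming distance of a linear code: the least weight of a nonzero codeword. -/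
noncomputable def minDist {K ι : Type*} [Field K] (D : Submodule K (ι → K)) : ℕ :=
  sInf {w : ℕ | ∃ c ∈ D, c ≠ 0 ∧ (Function.support c).ncard = w}

/-- The code `D|_E` obtained by restricting all codewords to the coordinates in `E`. -/
def restrictTo {K ι : Type*} [Field K] (D : Submodule K (ι → K)) (E : Finset ι) :
    Submodule K (E → K) :=
  D.map (LinearMap.funLeft K K (Subtype.val : E → ι))

/-- `D` is an `[n, k, n - k + 1]` MDS code. -/
def IsMDS {K ι : Type*} [Field K] (n k : ℕ) (D : Submodule K (ι → K)) : Prop :=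
  Nat.card ι = n ∧ k ≤ n ∧ Module.finrank K D = k ∧ minDist D = n - k + 1

/-- A family of vectors is `w`-wise independent over `F`: any at most `w` members
(at distinct indices) are linearly independent. -/
def WiseIndependent (F : Type*) {V ι : Type*} [Field F] [AddCommGroup V] [Module F V]
    (w : ℕ) (a : ι → V) : Prop :=
  ∀ T : Finset ι, T.card ≤ w → LinearIndepOn F a (T : Set ι)

/-! ### Hierarchical local codes

Coordinates are triples `(i, s, j)`: the `j`-th coordinate of the local group `B_{i,s}`
inside the middle group `A_i`, with `i ∈ [t₁]`, `s ∈ [t₂]`, `j ∈ [r₂ + δ]`. -/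

/-- The coordinate set of a hierarchical local code. -/
abbrev Coord (t₁ t₂ n₂ : ℕ) : Type := Fin t₁ × Fin t₂ × Fin n₂

/-- The middle group `A_i`. -/
def groupA {t₁ t₂ n₂ : ℕ} (i : Fin t₁) : Finset (Coord t₁ t₂ n₂) :=
  Finset.univ.filter fun x => x.1 = i

/-- The local group `B_{i,s}`. -/
def groupB {t₁ t₂ n₂ : ℕ} (i : Fin t₁) (s : Fin t₂) : Finset (Coord t₁ t₂ n₂) :=
  Finset.univ.filter fun x => x.1 = i ∧ x.2.1 = s

/-- The number of coordinates is `n = k + h₁ + t₁ (h₂ + t₂ δ)`, where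
`t₁ = (k + h₁) / r₁` and `t₂ = (r₁ + h₂) / r₂`. -/
theorem card_coord {k r₁ r₂ h₁ h₂ δ t₁ t₂ : ℕ} (ht₁ : t₁ * r₁ = k + h₁)
    (ht₂ : t₂ * r₂ = r₁ + h₂) :
    Fintype.card (Coord t₁ t₂ (r₂ + δ)) = k + h₁ + t₁ * (h₂ + t₂ * δ) := by
  simp only [Coord, Fintype.card_prod, Fintype.card_fin]
  calc t₁ * (t₂ * (r₂ + δ)) = t₁ * (t₂ * r₂ + t₂ * δ) := by ring
    _ = t₁ * r₁ + t₁ * (h₂ + t₂ * δ) := by rw [ht₂]; ring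
    _ = _ := by rw [ht₁]

/-- `C` is a `[k, r₁, r₂, h₁, h₂, δ]` hierarchical local code: it has dimension `k` and is
defined by `h₁` global parities, `h₂` mid-level parities in each `A_i` and `δ` local parities
in each `B_{i,s}`. -/
def IsHLCode {K : Type*} [Field K] (k r₁ r₂ h₁ h₂ δ : ℕ) {t₁ t₂ : ℕ}
    (C : Submodule K (Coord t₁ t₂ (r₂ + δ) → K)) : Prop :=
  t₁ * r₁ = k + h₁ ∧ t₂ * r₂ = r₁ + h₂ ∧ Module.finrank K C = k ∧
  ∃ (u : Fin h₁ → Coord t₁ t₂ (r₂ + δ) → K)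
    (v : Fin t₁ → Fin h₂ → Fin t₂ × Fin (r₂ + δ) → K)
    (w : Fin t₁ → Fin t₂ → Fin δ → Fin (r₂ + δ) → K),
    ∀ c : Coord t₁ t₂ (r₂ + δ) → K, c ∈ C ↔
      (∀ l, ∑ x, u l x * c x = 0) ∧
      (∀ i l, ∑ y : Fin t₂ × Fin (r₂ + δ), v i l y * c (i, y) = 0) ∧
      (∀ i s l, ∑ j, w i s l j * c (i, s, j) = 0)

/-- `C` is a `[k, r₁, r₂, h₁, h₂, δ]` hierarchical local maximally recoverable code. -/
def IsHLMRC {K : Type*} [Field K] (k r₁ r₂ h₁ h₂ δ : ℕ) {t₁ t₂ : ℕ}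
    (C : Submodule K (Coord t₁ t₂ (r₂ + δ) → K)) : Prop :=
  IsHLCode k r₁ r₂ h₁ h₂ δ C ∧
  ∀ E : Finset (Coord t₁ t₂ (r₂ + δ)), E.card = k + h₁ →
    (∀ i s, (E ∩ groupB i s).card ≤ r₂) → (∀ i, (E ∩ groupA i).card = r₁) →
    IsMDS (k + h₁) k (restrictTo C E)

/-! ### The parity-check matrix of the construction -/

/-- The matrix with rows `a, a^Q, a^(Q^2), …, a^(Q^(h-1))`. -/
def frobeniusRows {K ι : Type*} [Field K] (Q h : ℕ) (a : ι → K) : Matrix (Fin h) ι K :=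
  Matrix.of fun l x => a x ^ Q ^ (l : ℕ)

/-- `M₀`: the `δ × n₂` Vandermonde matrix with nodes `0, β, β², …, β^(n₂ - 1)`. -/
def matM₀ {K : Type*} [Field K] (δ n₂ : ℕ) (β : K) : Matrix (Fin δ) (Fin n₂) K :=
  Matrix.of fun l j => (if (j : ℕ) = 0 then 0 else β ^ (j : ℕ)) ^ (l : ℕ)

/-- `H₀`: `t₂` diagonal copies of `M₀` above the row block `[M₁ M₂ ⋯ M_{t₂}]`, where `M_s`
has rows `α_{s,·}, α_{s,·}^q, …, α_{s,·}^(q^(h₂-1))`. -/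
def matH₀ {K₀ K₁ : Type*} [Field K₀] [Field K₁] [Algebra K₀ K₁] (q h₂ δ : ℕ) {t₂ n₂ : ℕ}
    (β : K₀) (α : Fin t₂ × Fin n₂ → K₁) :
    Matrix ((Fin t₂ × Fin δ) ⊕ Fin h₂) (Fin t₂ × Fin n₂) K₁ :=
  Matrix.fromRows
    (Matrix.of fun x y => if x.1 = y.1 then algebraMap K₀ K₁ (matM₀ δ n₂ β x.2 y.2) else 0)
    (frobeniusRows q h₂ α)

/-- `H`: `t₁` diagonal copies of `H₀` above the row block `[H₁ H₂ ⋯ H_{t₁}]`, where `H_i`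
has rows `lam_{i,·}, lam_{i,·}^(q^m₁), …, lam_{i,·}^(q^(m₁ (h₁-1)))`. -/
def matH {K₀ K₁ K₂ : Type*} [Field K₀] [Field K₁] [Field K₂] [Algebra K₀ K₁] [Algebra K₁ K₂]
    (q m₁ h₁ h₂ δ : ℕ) {t₁ t₂ n₂ : ℕ} (β : K₀) (α : Fin t₂ × Fin n₂ → K₁)
    (lam : Coord t₁ t₂ n₂ → K₂) :
    Matrix ((Fin t₁ × ((Fin t₂ × Fin δ) ⊕ Fin h₂)) ⊕ Fin h₁) (Coord t₁ t₂ n₂) K₂ :=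
  Matrix.fromRows
    (Matrix.of fun x y =>
      if x.1 = y.1 then algebraMap K₁ K₂ (matH₀ q h₂ δ β α x.2 y.2) else 0)
    (frobeniusRows (q ^ m₁) h₁ lam)

/-- The code with parity-check matrix `matH`. -/
def codeOf {K₀ K₁ K₂ : Type*} [Field K₀] [Field K₁] [Field K₂] [Algebra K₀ K₁] [Algebra K₁ K₂]
    (q m₁ h₁ h₂ δ : ℕ) {t₁ t₂ n₂ : ℕ} (β : K₀) (α : Fin t₂ × Fin n₂ → K₁)
    (lam : Coord t₁ t₂ n₂ → K₂) : Submodule K₂ (Coord t₁ t₂ n₂ → K₂) :=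
  LinearMap.ker (matH q m₁ h₁ h₂ δ β α lam).mulVecLin

/-! ### BCH codes -/

/-- `C` is a BCH code over `F` of length `N` with designed distance `d`: for some primitive
`N`-th root of unity `γ` in an extension of `F` and some `b`, it consists of all words `c`
whose polynomial `∑ c_j X^j` vanishes at the `d - 1` points `γ^b, γ^(b+1), …, γ^(b+d-2)`. -/
def IsBCHCode {F : Type*} [Field F] {N : ℕ} (d : ℕ) (C : Submodule F (Fin N → F)) : Prop :=
  ∃ (γ : AlgebraicClosure F) (b : ℕ), IsPrimitiveRoot γ N ∧
    ∀ c : Fin N → F, c ∈ C ↔ ∀ i : ℕ, i + 1 < d →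
      ∑ j : Fin N, algebraMap F (AlgebraicClosure F) (c j) * (γ ^ (b + i)) ^ (j : ℕ) = 0

/-- The elements `a x` of `L` are distinct columns of a parity-check matrix of a BCH code over
`F` of length `N` with designed distance `d`. The matrix has `μ` rows, need not have full row
rank, and its columns are read as elements of `L` through an `F`-linear isomorphism
`F^μ ≃ L`. -/
def AreBCHColumns (F : Type*) {L ι : Type*} [Field F] [Field L] [Algebra F L]
    (N d μ : ℕ) (a : ι → L) : Prop :=
  ∃ C : Submodule F (Fin N → F), IsBCHCode d C ∧
    ∃ P : Matrix (Fin μ) (Fin N) F, LinearMap.ker P.mulVecLin = C ∧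
      ∃ (e : (Fin μ → F) ≃ₗ[F] L) (pos : ι ↪ Fin N), ∀ x, a x = e (P.col (pos x))

/-- The degree `⌈log_q n⌉` of the extension used for a BCH code over `𝔽_q` with `n` columns. -/
noncomputable def bchDegree (q n : ℕ) : ℕ := ⌈Real.logb q n⌉₊

/-- `1 + ⌈((q - 1) / q) (d - 2)⌉ ⌈log_q n⌉`. -/
noncomputable def bchRedundancy (q d n : ℕ) : ℕ :=
  1 + ⌈((q : ℝ) - 1) / q * ((d : ℝ) - 2)⌉₊ * bchDegree q n

/-- The choice of parameters: `β` is a primitive element of `K₀ = 𝔽_q`, the `α_{s,j}` are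
columns of a parity-check matrix with `m₁` rows of a BCH code over `𝔽_q` with designed distance
`(δ+1)h₂ + 1`, and the `lam_{i,s,j}` are columns of a parity-check matrix with `m / m₁` rows
of a BCH code over `K₁ = 𝔽_{q^m₁}` with designed distance `(δ+1)(h₂+1)h₁ + 1`. -/
def IsBCHChoice {K₀ K₁ K₂ : Type*} [Field K₀] [Field K₁] [Field K₂] [Algebra K₀ K₁]
    [Algebra K₁ K₂] (q m₁ m h₁ h₂ δ : ℕ) {t₁ t₂ n₂ : ℕ} (β : K₀) (α : Fin t₂ × Fin n₂ → K₁)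
    (lam : Coord t₁ t₂ n₂ → K₂) : Prop :=
  IsPrimitiveRoot β (q - 1) ∧
  AreBCHColumns K₀ (q ^ bchDegree q (n₂ * t₂) - 1) ((δ + 1) * h₂ + 1) m₁ α ∧
  AreBCHColumns K₁ ((q ^ m₁) ^ bchDegree (q ^ m₁) (t₁ * t₂ * n₂) - 1)
    ((δ + 1) * (h₂ + 1) * h₁ + 1) (m / m₁) lam

end HLMRC

/-!
The code is maximally recoverable once, for each admissible set `E` and each `S ⊆ E` of size `h₁`,
the columns of `H` with indices in `Eᶜ ∪ S` are linearly independent: there are as many of them as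
rows, so the code has dimension `k`, and no nonzero codeword has weight at most `h₁` on `E`
(`isMDS_restrictTo_ker`).

Independence is obtained by passing twice through the same step, `ColsIndep.fromRows_frobeniusRows`.
Let `M` be a matrix over a field `F` with `Q` elements and let `T` be an independent set of columns
with as many elements as `M` has rows. For `s ∉ T` there is a unique kernel vector `g s` supported
on `T ∪ {s}` with `g s s = 1`. A vector over an extension field supported on `T ∪ S` and killed
by `M` is the combination of the `g s`, `s ∈ S`, with coefficients `c s`; Frobenius rows in `lam`
then say that `c` solves the Moore system of the elements `∑ x, g s x • lam x`. These elements
are independent over `F`, because the `lam x` are independent on the union of the supports of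
the `g s`, and so `c = 0` (`moore_injective`).

The first pass has `F = K₀`, `M` the diagonal copies of the Vandermonde matrix `M₀`, `T` a choice of
`δ` indices of `Eᶜ` in each local group, and supports of size at most `δ + 1`. The second has
`F = K₁`, `M` the diagonal copies of `H₀`, `T = Eᶜ`, and supports of size at most
`(δ + 1) (h₂ + 1)`: a kernel vector of `M₀` supported on `δ` indices vanishes, so only the local
groups of at most `h₂ + 1` indices contribute (`colsIndep_matH₀`).

The independence of the parameters is the BCH bound. For their existence one takes `b = 0`, for
which the redundancy of the BCH code is small enough (`exists_areBCHColumns`); the code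
is long enough because `n₂` divides no power of `q`, by Bertrand's postulate
(`not_dvd_pow_of_isLeast`).
-/

namespace HLMRC

open Matrix Polynomial

/-! ### Vandermonde and Moore systems -/

/-- A Vandermonde system with distinct nodes has no nonzero solution with as few nonzero
entries as it has equations: pair the equations with the coefficients of the polynomial
vanishing at all other nodes of the support. -/
theorem eq_zero_of_forall_sum_mul_pow_eq_zero {K ι : Type*} [Field K] [Fintype ι] {node c : ι → K}
    {T : Finset ι} {d : ℕ} (hnode : Set.InjOn node T) (hcard : T.card ≤ d)
    (hc : ∀ x, x ∉ T → c x = 0) (h : ∀ l < d, ∑ x, c x * node x ^ l = 0) : c = 0 := by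
  classical
  funext y
  by_cases hy : y ∈ T
  swap
  · exact hc y hy
  set p : K[X] := ∏ x ∈ T.erase y, (X - C (node x)) with hp
  have hdeg : p.natDegree < d := by
    rw [hp, natDegree_prod_of_monic _ _ (fun x _ => monic_X_sub_C _)]
    simp only [natDegree_X_sub_C, Finset.sum_const, smul_eq_mul, mul_one]
    exact lt_of_lt_of_le (Finset.card_erase_lt_of_mem hy) hcard
  have hsum : ∑ x, c x * p.eval (node x) = 0 := by
    simp_rw [eval_eq_sum_range' hdeg, Finset.mul_sum]
    rw [Finset.sum_comm]
    refine Finset.sum_eq_zero fun l hl => ?_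
    have := h l (Finset.mem_range.1 hl)
    calc ∑ x, c x * (p.coeff l * node x ^ l) = p.coeff l * ∑ x, c x * node x ^ l := by
          rw [Finset.mul_sum]; exact Finset.sum_congr rfl fun x _ => by ring
      _ = 0 := by rw [this, mul_zero]
  rw [Finset.sum_eq_single y] at hsum
  · refine (mul_eq_zero.1 hsum).resolve_right ?_
    rw [hp, eval_prod, ← ne_eq, Finset.prod_ne_zero_iff]
    intro x hx
    rw [eval_sub, eval_X, eval_C, sub_ne_zero]
    exact fun e => (Finset.ne_of_mem_erase hx) (hnode hy (Finset.mem_of_mem_erase hx) e).symm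
  · intro x _ hxy
    by_cases hx : x ∈ T
    · rw [hp, eval_prod, Finset.prod_eq_zero (Finset.mem_erase.2 ⟨hxy, hx⟩) (by simp), mul_zero]
    · rw [hc x hx, zero_mul]
  · simp

/-- The map `x ↦ x ^ Q ^ l` is linear over a field with `Q` elements. -/
theorem exists_algHom_pow_card {F : Type*} (K : Type*) [Field F] [Finite F] [Field K]
    [Algebra F K] {Q : ℕ} (hQ : Nat.card F = Q) (l : ℕ) :
    ∃ φ : K →ₐ[F] K, ∀ x, φ x = x ^ Q ^ l := by
  have := Fintype.ofFinite F
  refine ⟨FiniteField.frobeniusAlgHom F K ^ l, fun x => ?_⟩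
  rw [AlgHom.coe_pow, FiniteField.coe_frobeniusAlgHom, ← Nat.card_eq_fintype_card, hQ]
  exact congrFun (pow_iterate Q l) x

/-- Moore matrices of linearly independent elements are invertible. A left null vector would be
the coefficient vector of a polynomial of degree at most `Q ^ (n - 1)` vanishing on the
`Q ^ n` elements of the span. -/
theorem moore_injective {F K : Type*} [Field F] [Finite F] [Field K] [Algebra F K] {Q n : ℕ}
    (hQ : Nat.card F = Q) {v : Fin n → K} (hv : LinearIndependent F v) {z : Fin n → K}
    (h : ∀ l < n, ∑ s, z s * v s ^ Q ^ l = 0) : z = 0 := by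
  classical
  have hQ1 : 1 < Q := hQ ▸ Finite.one_lt_card
  by_contra hz
  set A : Matrix (Fin n) (Fin n) K := of fun l s => v s ^ Q ^ (l : ℕ) with hA
  -- a right null vector of the square matrix `A` gives a left null vector `a`
  have hdet : A.det = 0 := by
    refine Matrix.exists_mulVec_eq_zero_iff.1 ⟨z, hz, ?_⟩
    funext l
    simpa [hA, mulVec, dotProduct, mul_comm] using h l l.2
  obtain ⟨a, ha, haA⟩ := Matrix.exists_vecMul_eq_zero_iff.2 hdet
  set p : K[X] := ∑ l : Fin n, C (a l) * X ^ Q ^ (l : ℕ) with hp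
  have hp0 : p ≠ 0 := by
    obtain ⟨l, hl⟩ := Function.ne_iff.1 ha
    intro h0
    apply hl
    have := congrArg (fun r => r.coeff (Q ^ (l : ℕ))) h0
    simp only [hp, finsetSum_coeff, coeff_C_mul, coeff_X_pow, coeff_zero] at this
    rw [Finset.sum_eq_single l] at this
    · simpa using this
    · intro b _ hb
      rw [if_neg, mul_zero]
      exact fun e => hb (Fin.ext (Nat.pow_right_injective hQ1 e).symm)
    · simp
  have hn : 0 < n := by
    rcases Nat.eq_zero_or_pos n with rfl | hn
    · exact absurd (Subsingleton.elim a 0) ha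
    · exact hn
  have hdeg : p.natDegree ≤ Q ^ (n - 1) := by
    refine natDegree_sum_le_of_forall_le _ _ fun l _ => ?_
    refine (natDegree_C_mul_X_pow_le _ _).trans (Nat.pow_le_pow_right hQ1.le ?_)
    have := l.2
    omega
  have hroot : ∀ f : Fin n → F, p.IsRoot (∑ s, f s • v s) := by
    intro f
    rw [IsRoot.def, hp, eval_finsetSum]
    have key : ∀ l : Fin n, eval (∑ s, f s • v s) (C (a l) * X ^ Q ^ (l : ℕ))
        = ∑ s, f s • (a l * v s ^ Q ^ (l : ℕ)) := by
      intro l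
      obtain ⟨φ, hφ⟩ := exists_algHom_pow_card K hQ l
      rw [eval_mul, eval_C, eval_pow, eval_X, ← hφ, map_sum, Finset.mul_sum]
      refine Finset.sum_congr rfl fun s _ => ?_
      rw [map_smul, hφ, mul_smul_comm]
    simp_rw [key]
    rw [Finset.sum_comm]
    refine Finset.sum_eq_zero fun s _ => ?_
    rw [← Finset.smul_sum]
    have := congrFun haA s
    simp only [vecMul, dotProduct, hA, of_apply, Pi.zero_apply] at this
    rw [this, smul_zero]
  have := Fintype.ofFinite F
  have hinj : Function.Injective fun f : Fin n → F => ∑ s, f s • v s := fun f g hfg =>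
    hv.fintypeLinearCombination_injective (by simpa [Fintype.linearCombination_apply] using hfg)
  have hcard : Q ^ n ≤ p.natDegree := by
    calc Q ^ n = (Finset.univ.image fun f : Fin n → F => ∑ s, f s • v s).card := by
          rw [Finset.card_image_of_injective _ hinj, Finset.card_univ, Fintype.card_fun,
            Fintype.card_fin, ← Nat.card_eq_fintype_card, hQ]
      _ ≤ p.roots.toFinset.card := by
          refine Finset.card_le_card fun y hy => ?_
          obtain ⟨f, -, rfl⟩ := Finset.mem_image.1 hy
          rw [Multiset.mem_toFinset, mem_roots hp0]
          exact hroot f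
      _ ≤ p.roots.card := Multiset.toFinset_card_le _
      _ ≤ p.natDegree := p.card_roots'
  have : Q ^ (n - 1) < Q ^ n := Nat.pow_lt_pow_right hQ1 (by omega)
  omega

/-- The Moore system of elements independent over `F`, with at least as many equations as unknowns,
has only the zero solution. -/
theorem eq_zero_of_moore_system {F K σ : Type*} [Field F] [Finite F] [Field K] [Algebra F K]
    {Q h : ℕ} (hQ : Nat.card F = Q) {S : Finset σ} (hS : S.card ≤ h) {v : σ → K}
    (hv : LinearIndepOn F v (S : Set σ)) {z : σ → K}
    (hz : ∀ l < h, ∑ s ∈ S, z s * v s ^ Q ^ l = 0) : ∀ s ∈ S, z s = 0 := by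
  let e : Fin S.card ≃ S := S.equivFin.symm
  have h1 : LinearIndependent F fun i => v (e i) := hv.comp e e.injective
  have h2 := moore_injective hQ h1 (z := fun i => z (e i)) (fun l hl => by
    rw [← hz l (hl.trans_le hS), ← Finset.sum_coe_sort S]
    exact e.sum_comp (fun s : S => z s * v s ^ Q ^ l))
  intro s hs
  simpa using congrFun h2 (e.symm ⟨s, hs⟩)

/-! ### Independent sets of columns -/

/-- The columns of `M` with indices in `T` are linearly independent, phrased as: the only vector
in the kernel of `M` supported on `T` is zero. -/
def ColsIndep {F m ι : Type*} [Field F] [Fintype ι] (M : Matrix m ι F) (T : Finset ι) : Prop :=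
  ∀ c : ι → F, (∀ x, x ∉ T → c x = 0) → M *ᵥ c = 0 → c = 0

/-- Independence of columns survives an extension of scalars: apply linear functionals to a
kernel vector over the larger field. -/
theorem ColsIndep.map {F m ι : Type*} [Field F] [Fintype ι] {M : Matrix m ι F}
    {T : Finset ι} (hM : ColsIndep M T) (K : Type*) [Field K] [Algebra F K] :
    ColsIndep (M.map (algebraMap F K)) T := by
  intro c hc h
  funext x
  refine (Module.forall_dual_apply_eq_zero_iff F (c x)).1 fun φ => ?_
  refine congrFun (hM (fun y => φ (c y)) (fun y hy => by rw [hc y hy, map_zero]) ?_) x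
  funext i
  have := congrArg φ (congrFun h i)
  simpa [mulVec, dotProduct, ← Algebra.smul_def] using this

/-- If an independent set of columns is at least as large as the number of rows, every further
column `x` is a combination of it. -/
theorem ColsIndep.exists_kernel_vector {F m ι : Type*} [Field F] [Fintype ι] [Fintype m]
    [DecidableEq ι] {M : Matrix m ι F} {T : Finset ι} (hM : ColsIndep M T)
    (hcard : Fintype.card m ≤ T.card) {x : ι} (hx : x ∉ T) :
    ∃ g : ι → F, M *ᵥ g = 0 ∧ g x = 1 ∧ ∀ y, y ∉ insert x T → g y = 0 := by
  let ext : ({y // y ∈ insert x T} → F) →ₗ[F] ι → F := Function.ExtendByZero.linearMap F Subtype.val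
  have hext : ∀ g y, (hy : y ∈ insert x T) → ext g y = g ⟨y, hy⟩ := fun g y hy =>
    Subtype.val_injective.extend_apply g 0 (⟨y, hy⟩ : {y // y ∈ insert x T})
  have hext0 : ∀ g y, y ∉ insert x T → ext g y = 0 := fun g y hy =>
    Function.extend_apply' _ _ _ (by rintro ⟨a, rfl⟩; exact hy a.2)
  have hker : LinearMap.ker (M.mulVecLin ∘ₗ ext) ≠ ⊥ := by
    apply LinearMap.ker_ne_bot_of_finrank_lt
    rw [Module.finrank_fintype_fun_eq_card, Module.finrank_fintype_fun_eq_card, Fintype.card_coe,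
      Finset.card_insert_of_notMem hx]
    omega
  obtain ⟨g, hg, hg0⟩ := Submodule.exists_mem_ne_zero_of_ne_bot hker
  have hMg : M *ᵥ ext g = 0 := by simpa using hg
  have hgx : ext g x ≠ 0 := by
    intro h0
    apply hg0
    have : ext g = 0 := by
      refine hM _ (fun y hy => ?_) hMg
      by_cases hyx : y = x
      · rw [hyx, h0]
      · exact hext0 g y (by simp [hyx, hy])
    funext y
    rw [← hext g y y.2, this]
    rfl
  refine ⟨(ext g x)⁻¹ • ext g, ?_, ?_, fun y hy => ?_⟩
  · rw [mulVec_smul, hMg, smul_zero]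
  · simp [hgx]
  · simp [hext0 g y hy]

/-- Adding Frobenius rows. Let `M` be a matrix over a field `F` of size `Q` with an independent
set `T` of as many columns as rows, and suppose that the kernel vectors of `M` supported on `T` and
one further index in `S` have weight at most `u`. If the `lam x` are `u * h`-wise independent
over `F`, then `h` Frobenius rows added to `M` make `T ∪ S` independent for `S.card ≤ h`.

A kernel vector supported on `T ∪ S` is a combination of the kernel vectors `g s` with
`g s s = 1`, and its coefficients solve the Moore system of the elements `∑ x, g s x • lam x`. -/
theorem ColsIndep.fromRows_frobeniusRows {F K m ι : Type*} [Field F] [Finite F] [Field K]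
    [Algebra F K] [Fintype ι] [Fintype m] [DecidableEq ι] {Q h u : ℕ} (hQ : Nat.card F = Q)
    {M : Matrix m ι F} {T S : Finset ι} (hM : ColsIndep M T) (hcard : Fintype.card m ≤ T.card)
    (hTS : Disjoint T S) (hS : S.card ≤ h)
    (hu : ∀ s ∈ S, ∀ g : ι → F, M *ᵥ g = 0 → (∀ y, y ∉ insert s T → g y = 0) →
      ∃ U : Finset ι, U.card ≤ u ∧ ∀ y, y ∉ U → g y = 0)
    {lam : ι → K} (hlam : WiseIndependent F (u * h) lam) :
    ColsIndep (fromRows (M.map (algebraMap F K)) (frobeniusRows Q h lam)) (T ∪ S) := by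
  intro c hc hker
  rw [fromRows_mulVec] at hker
  have hker1 : M.map (algebraMap F K) *ᵥ c = 0 := funext fun i => congrFun hker (Sum.inl i)
  have hker2 : frobeniusRows Q h lam *ᵥ c = 0 := funext fun i => congrFun hker (Sum.inr i)
  have hnot : ∀ s ∈ S, s ∉ T := fun s hs ht => Finset.disjoint_left.1 hTS ht hs
  have hex : ∀ s, ∃ g : ι → F, s ∈ S →
      (M *ᵥ g = 0 ∧ g s = 1 ∧ ∀ y, y ∉ insert s T → g y = 0) := by
    intro s
    by_cases hs : s ∈ S
    · obtain ⟨g, hg⟩ := hM.exists_kernel_vector hcard (hnot s hs)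
      exact ⟨g, fun _ => hg⟩
    · exact ⟨0, fun h => absurd h hs⟩
  choose g hg using hex
  have hU : ∀ s, ∃ U : Finset ι, s ∈ S → U.card ≤ u ∧ ∀ y, y ∉ U → g s y = 0 := by
    intro s
    by_cases hs : s ∈ S
    · obtain ⟨U, hU⟩ := hu s hs (g s) (hg s hs).1 (hg s hs).2.2
      exact ⟨U, fun _ => hU⟩
    · exact ⟨∅, fun h => absurd h hs⟩
  choose U hU using hU
  have hgS : ∀ s ∈ S, ∀ y ∈ S, g s y = if y = s then 1 else 0 := by
    intro s hs y hy
    split_ifs with e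
    · rw [e, (hg s hs).2.1]
    · exact (hg s hs).2.2 y (by simp [e, hnot y hy])
  -- the kernel vector is the combination of the `g s` with coefficients `c s`
  have hcg : ∀ x, c x = ∑ s ∈ S, c s * algebraMap F K (g s x) := by
    have h0 : (fun x => c x - ∑ s ∈ S, c s * algebraMap F K (g s x)) = 0 := by
      refine hM.map K _ (fun x hx => ?_) ?_
      · by_cases hxS : x ∈ S
        · rw [Finset.sum_eq_single x]
          · rw [(hg x hxS).2.1, map_one, mul_one, sub_self]
          · intro s hs hsx
            rw [hgS s hs x hxS, if_neg hsx.symm, map_zero, mul_zero]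
          · exact fun h => absurd hxS h
        · rw [hc x (by simp [hx, hxS]), zero_sub, neg_eq_zero]
          refine Finset.sum_eq_zero fun s hs => ?_
          rw [(hg s hs).2.2 x, map_zero, mul_zero]
          have : x ≠ s := fun e => hxS (e ▸ hs)
          simp [this, hx]
      · have hsplit : (fun x => c x - ∑ s ∈ S, c s * algebraMap F K (g s x))
            = c - ∑ s ∈ S, c s • fun x => algebraMap F K (g s x) := by
          funext x; simp
        rw [hsplit, mulVec_sub, hker1, zero_sub, neg_eq_zero, mulVec_sum]
        refine Finset.sum_eq_zero fun s hs => ?_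
        rw [mulVec_smul]
        have : M.map (algebraMap F K) *ᵥ (fun x => algebraMap F K (g s x)) = 0 := by
          have := RingHom.map_mulVec (algebraMap F K) M (g s)
          funext i
          have h1 := this i
          rw [(hg s hs).1] at h1
          simpa [Function.comp_def] using h1.symm
        rw [this, smul_zero]
    exact fun x => sub_eq_zero.1 (congrFun h0 x)
  -- the elements of the Moore system, independent as each involves at most `u` of the `lam x`
  set mu : ι → K := fun s => ∑ x, g s x • lam x with hmu
  have hindep : LinearIndepOn F mu (S : Set ι) := by
    rw [linearIndepOn_finset_iff]
    intro f hf s hs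
    have hcardU : (S.biUnion U).card ≤ u * h :=
      calc (S.biUnion U).card ≤ S.card * u := Finset.card_biUnion_le_card_mul _ _ _
            fun s hs => (hU s hs).1
        _ ≤ u * h := by rw [mul_comm]; exact Nat.mul_le_mul_left _ hS
    have hout : ∀ y, y ∉ S.biUnion U → ∑ s ∈ S, f s * g s y = 0 := by
      intro y hy
      refine Finset.sum_eq_zero fun s hs => ?_
      rw [(hU s hs).2 y (fun h => hy (Finset.mem_biUnion.2 ⟨s, hs, h⟩)), mul_zero]
    have hrel : ∑ y ∈ S.biUnion U, (∑ s ∈ S, f s * g s y) • lam y = 0 := by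
      rw [Finset.sum_subset (Finset.subset_univ _)
        (fun y _ hy => by rw [hout y hy, zero_smul]), ← hf]
      simp_rw [hmu, Finset.smul_sum, Finset.sum_smul, mul_smul]
      rw [Finset.sum_comm]
    have hall : ∀ y, ∑ s ∈ S, f s * g s y = 0 := by
      intro y
      by_cases hy : y ∈ S.biUnion U
      · exact linearIndepOn_finset_iff.1 (hlam _ hcardU) _ hrel y hy
      · exact hout y hy
    have := hall s
    rw [Finset.sum_eq_single s] at this
    · rwa [(hg s hs).2.1, mul_one] at this
    · intro t ht hts
      rw [hgS t ht s hs, if_neg hts.symm, mul_zero]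
    · exact fun h => absurd hs h
  have hzero : ∀ s ∈ S, c s = 0 := by
    refine eq_zero_of_moore_system hQ hS hindep fun l hl => ?_
    obtain ⟨φ, hφ⟩ := exists_algHom_pow_card K hQ l
    have hrow := congrFun hker2 ⟨l, hl⟩
    simp only [mulVec, dotProduct, frobeniusRows, of_apply, Pi.zero_apply] at hrow
    rw [← hrow]
    calc ∑ s ∈ S, c s * mu s ^ Q ^ l
        = ∑ s ∈ S, ∑ x, lam x ^ Q ^ l * (c s * algebraMap F K (g s x)) := by
          refine Finset.sum_congr rfl fun s _ => ?_
          rw [← hφ, hmu, map_sum, Finset.mul_sum]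
          refine Finset.sum_congr rfl fun x _ => ?_
          rw [map_smul, hφ, Algebra.smul_def]
          ring
      _ = ∑ x, lam x ^ Q ^ l * c x := by
          rw [Finset.sum_comm]
          refine Finset.sum_congr rfl fun x _ => ?_
          rw [← Finset.mul_sum, ← hcg x]
  funext x
  rw [hcg x]
  exact Finset.sum_eq_zero fun s hs => by rw [hzero s hs, zero_mul]

/-! ### Maximally recoverable restrictions are MDS -/

theorem finrank_ker_ge {K m ι : Type*} [Field K] [Fintype ι] [Fintype m] (H : Matrix m ι K)
    {k : ℕ} (hcard : Fintype.card m + k = Fintype.card ι) :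
    k ≤ Module.finrank K (LinearMap.ker H.mulVecLin) := by
  have h1 := LinearMap.finrank_range_add_finrank_ker H.mulVecLin
  have h2 := (LinearMap.range H.mulVecLin).finrank_le
  rw [Module.finrank_fintype_fun_eq_card] at h1 h2
  omega

/-- If the columns outside a set `I` of size `k` are independent, then `I` determines the
codewords. -/
theorem finrank_ker_le {K m ι : Type*} [Field K] [Fintype ι] [DecidableEq ι] {H : Matrix m ι K}
    {I : Finset ι} (hI : ColsIndep H Iᶜ) :
    Module.finrank K (LinearMap.ker H.mulVecLin) ≤ I.card := by
  let f : LinearMap.ker H.mulVecLin →ₗ[K] (I → K) :=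
    LinearMap.funLeft K K (Subtype.val : I → ι) ∘ₗ (LinearMap.ker H.mulVecLin).subtype
  have hf : Function.Injective f := by
    rw [← LinearMap.ker_eq_bot, LinearMap.ker_eq_bot']
    intro c hc
    refine Subtype.ext (hI c (fun x hx => ?_) c.2)
    simp only [Finset.mem_compl, not_not] at hx
    exact congrFun hc ⟨x, hx⟩
  have := LinearMap.finrank_le_finrank_of_injective hf
  rwa [Module.finrank_fintype_fun_eq_card, Fintype.card_coe] at this

/-- The support of a restricted word, as a finset of the original index set. -/
theorem ncard_support_restrict {K ι : Type*} [Field K] [DecidableEq ι] [DecidableEq K]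
    (E : Finset ι) (c : ι → K) :
    (Function.support (LinearMap.funLeft K K (Subtype.val : E → ι) c)).ncard
      = (E.filter fun x => c x ≠ 0).card := by
  rw [← Set.ncard_image_of_injective _ Subtype.val_injective, ← Set.ncard_coe_finset]
  congr 1
  ext x
  simp [LinearMap.funLeft, and_comm]

/-- If `Eᶜ ∪ S` is a set of independent columns of the parity-check matrix `H` for all `h`-subsets
`S` of a set `E` of `k + h` coordinates, then the restriction to `E` has length `k + h`,
dimension `k` and minimum distance `h + 1`. -/
theorem isMDS_restrictTo_ker {K m ι : Type*} [Field K] [Fintype ι] [Fintype m] [DecidableEq ι]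
    {H : Matrix m ι K} {k h : ℕ} (hk : 0 < k) (hcard : Fintype.card m + k = Fintype.card ι)
    {E : Finset ι} (hE : E.card = k + h)
    (hind : ∀ S ⊆ E, S.card = h → ColsIndep H (Eᶜ ∪ S)) :
    Module.finrank K (LinearMap.ker H.mulVecLin) = k ∧
      IsMDS (k + h) k (restrictTo (LinearMap.ker H.mulVecLin) E) := by
  classical
  have hlow : ∀ c ∈ LinearMap.ker H.mulVecLin, (E.filter fun x => c x ≠ 0).card ≤ h → c = 0 := by
    intro c hc hw
    obtain ⟨S, hS1, hS2, hS3⟩ := Finset.exists_subsuperset_card_eq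
      (Finset.filter_subset (fun x => c x ≠ 0) E) hw (by omega)
    refine hind S hS2 hS3 c (fun x hx => ?_) hc
    simp only [Finset.mem_union, Finset.mem_compl, not_or, not_not] at hx
    by_contra h0
    exact hx.2 (hS1 (Finset.mem_filter.2 ⟨hx.1, h0⟩))
  have hdim : Module.finrank K (LinearMap.ker H.mulVecLin) = k := by
    refine le_antisymm ?_ (finrank_ker_ge H hcard)
    obtain ⟨S, hS, hSc⟩ := Finset.exists_subset_card_eq (show h ≤ E.card by omega)
    have hcompl : Eᶜ ∪ S = (E \ S)ᶜ := by
      ext x; simp only [Finset.mem_union, Finset.mem_compl, Finset.mem_sdiff]; tauto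
    have := finrank_ker_le (hcompl ▸ hind S hS hSc)
    rw [Finset.card_sdiff_of_subset hS] at this
    omega
  have hinj : Function.Injective ((LinearMap.funLeft K K (Subtype.val : E → ι)).domRestrict
      (LinearMap.ker H.mulVecLin)) := by
    rw [← LinearMap.ker_eq_bot, LinearMap.ker_eq_bot']
    intro c hc
    refine Subtype.ext (hlow c c.2 ?_)
    rw [← ncard_support_restrict]
    have : LinearMap.funLeft K K (Subtype.val : E → ι) c = 0 := hc
    rw [this]
    simp
  refine ⟨hdim, by simp [hE], by omega, ?_, ?_⟩
  · rw [restrictTo, ← LinearMap.range_domRestrict, LinearMap.finrank_range_of_inj hinj, hdim]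
  -- Singleton: some nonzero codeword vanishes on `k - 1` prescribed coordinates of `E`
  have hex : ∃ c ∈ LinearMap.ker H.mulVecLin, c ≠ 0 ∧ (E.filter fun x => c x ≠ 0).card ≤ h + 1 := by
    obtain ⟨I, hI, hIc⟩ := Finset.exists_subset_card_eq (show k - 1 ≤ E.card by omega)
    let f : LinearMap.ker H.mulVecLin →ₗ[K] (I → K) :=
      LinearMap.funLeft K K (Subtype.val : I → ι) ∘ₗ (LinearMap.ker H.mulVecLin).subtype
    have hker : LinearMap.ker f ≠ ⊥ := by
      apply LinearMap.ker_ne_bot_of_finrank_lt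
      rw [Module.finrank_fintype_fun_eq_card, Fintype.card_coe, hdim]
      omega
    obtain ⟨c, hc, hc0⟩ := Submodule.exists_mem_ne_zero_of_ne_bot hker
    refine ⟨c, c.2, fun e => hc0 (Subtype.ext e), ?_⟩
    have hsub : (E.filter fun x => (c : ι → K) x ≠ 0) ⊆ E \ I := by
      intro x hx
      rw [Finset.mem_filter] at hx
      exact Finset.mem_sdiff.2 ⟨hx.1, fun hxI => hx.2 (congrFun hc ⟨x, hxI⟩)⟩
    have := Finset.card_le_card hsub
    rw [Finset.card_sdiff_of_subset hI] at this
    omega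
  have hmem : ∀ w ∈ {w : ℕ | ∃ c ∈ restrictTo (LinearMap.ker H.mulVecLin) E, c ≠ 0 ∧
      (Function.support c).ncard = w}, h + 1 ≤ w := by
    rintro w ⟨_, ⟨c, hc, rfl⟩, hc0, rfl⟩
    rw [ncard_support_restrict]
    by_contra hlt
    exact hc0 (by rw [hlow c hc (by omega), map_zero])
  obtain ⟨c, hc, hc0, hw⟩ := hex
  have hin : (Function.support (LinearMap.funLeft K K (Subtype.val : E → ι) c)).ncard ∈
      {w : ℕ | ∃ c ∈ restrictTo (LinearMap.ker H.mulVecLin) E, c ≠ 0 ∧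
      (Function.support c).ncard = w} := by
    refine ⟨_, ⟨c, hc, rfl⟩, fun e => hc0 ?_, rfl⟩
    refine congrArg Subtype.val (hinj (a₁ := ⟨c, hc⟩) (a₂ := 0) ?_)
    rw [map_zero]
    exact e
  have h1 := Nat.sInf_le hin
  have h2 := hmem _ (Nat.sInf_mem ⟨_, hin⟩)
  rw [ncard_support_restrict] at h1
  change sInf _ = _
  omega

/-! ### Diagonal copies of a matrix -/

/-- The block-diagonal matrix with one copy of `N` for each element of `a`. -/
def diagCopies {F : Type*} [Field F] (a : Type*) [DecidableEq a] {r b : Type*} (N : Matrix r b F) :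
    Matrix (a × r) (a × b) F :=
  of fun x y => if x.1 = y.1 then N x.2 y.2 else 0

/-- The part of `T ⊆ a × b` with first coordinate `i`, as a subset of `b`. -/
def slice {a b : Type*} [Fintype b] [DecidableEq a] [DecidableEq b] (T : Finset (a × b)) (i : a) :
    Finset b :=
  Finset.univ.filter fun y => (i, y) ∈ T

section diag

variable {F a b r : Type*} [Field F] [DecidableEq a]

theorem mem_slice [Fintype b] [DecidableEq b] {T : Finset (a × b)} {i : a} {y : b} :
    y ∈ slice T i ↔ (i, y) ∈ T := by
  simp [slice]

theorem card_slice [Fintype b] [DecidableEq b] (T : Finset (a × b)) (i : a) :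
    (slice T i).card = (T.filter fun x => x.1 = i).card := by
  rw [← Finset.card_image_of_injective (slice T i) (Prod.mk_right_injective i)]
  congr 1
  ext ⟨j, y⟩
  simp only [Finset.mem_image, mem_slice, Prod.mk.injEq, Finset.mem_filter]
  constructor
  · rintro ⟨y, hy, rfl, rfl⟩
    exact ⟨hy, rfl⟩
  · rintro ⟨hy, rfl⟩
    exact ⟨y, hy, rfl, rfl⟩

theorem sum_card_slice [Fintype a] [Fintype b] [DecidableEq b] (T : Finset (a × b)) :
    ∑ i, (slice T i).card = T.card := by
  simp_rw [card_slice]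
  exact (Finset.card_eq_sum_card_fiberwise (fun x _ => Finset.mem_univ x.1)).symm

theorem diagCopies_mulVec [Fintype a] [Fintype b] (N : Matrix r b F) (c : a × b → F) (x : a × r) :
    (diagCopies a N *ᵥ c) x = (N *ᵥ fun y => c (x.1, y)) x.2 := by
  simp [mulVec, dotProduct, diagCopies, Fintype.sum_prod_type, ite_mul,
    Finset.sum_ite_irrel]

theorem mulVec_slice_eq_zero [Fintype a] [Fintype b] {N : Matrix r b F} {c : a × b → F}
    (h : diagCopies a N *ᵥ c = 0)
    (i : a) : (N *ᵥ fun y => c (i, y)) = 0 :=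
  funext fun l => by rw [← diagCopies_mulVec N c (i, l), h]; rfl

theorem map_diagCopies {K : Type*} [Field K] [Algebra F K] (N : Matrix r b F) :
    (diagCopies a N).map (algebraMap F K) = diagCopies a (N.map (algebraMap F K)) := by
  ext x y
  simp [diagCopies, apply_ite (algebraMap F K)]

theorem ColsIndep.diagCopies [Fintype a] [Fintype b] [DecidableEq b] {N : Matrix r b F}
    {T : Finset (a × b)}
    (h : ∀ i, ColsIndep N (slice T i)) : ColsIndep (diagCopies a N) T := by
  intro c hc hker
  funext ⟨i, y⟩
  exact congrFun (h i (fun y => c (i, y)) (fun y hy => hc _ (fun h => hy (mem_slice.2 h)))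
    (mulVec_slice_eq_zero hker i)) y

/-- A kernel vector of `diagCopies a N` supported on `L ∪ R`, where `L` meets each block in an
independent set of at most `δ` columns, vanishes on the blocks not touched by `R`, so each
element of `R` accounts for at most `δ + 1` entries. -/
theorem exists_small_support [Fintype a] [Fintype b] [DecidableEq b] {N : Matrix r b F}
    {L R : Finset (a × b)} {δ : ℕ}
    (hL : ∀ i, (slice L i).card ≤ δ) (hN : ∀ i, ColsIndep N (slice L i)) {g : a × b → F}
    (hker : HLMRC.diagCopies a N *ᵥ g = 0) (hg : ∀ y, y ∉ L ∪ R → g y = 0) :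
    ∃ U : Finset (a × b), U.card ≤ (δ + 1) * R.card ∧ ∀ y, y ∉ U → g y = 0 := by
  refine ⟨R ∪ (R.image Prod.fst).biUnion fun i => (slice L i).image (Prod.mk i), ?_, ?_⟩
  · have h1 : ((R.image Prod.fst).biUnion fun i => (slice L i).image (Prod.mk i)).card
        ≤ R.card * δ :=
      (Finset.card_biUnion_le_card_mul _ _ δ
        fun i _ => Finset.card_image_le.trans (hL i)).trans
        (Nat.mul_le_mul_right _ Finset.card_image_le)
    calc _ ≤ R.card + R.card * δ := (Finset.card_union_le _ _).trans (Nat.add_le_add_left h1 _)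
      _ = _ := by ring
  · rintro ⟨i, y⟩ hy
    rw [Finset.mem_union, not_or, Finset.mem_biUnion] at hy
    obtain ⟨hyR, hyU⟩ := hy
    by_cases hi : i ∈ R.image Prod.fst
    · refine hg _ fun h => ?_
      rcases Finset.mem_union.1 h with h | h
      · exact hyU ⟨i, hi, Finset.mem_image_of_mem _ (mem_slice.2 h)⟩
      · exact hyR h
    · refine congrFun (hN i (fun y => g (i, y)) (fun y hy => hg _ fun h => ?_)
        (mulVec_slice_eq_zero hker i)) y
      rcases Finset.mem_union.1 h with h | h
      · exact hy (mem_slice.2 h)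
      · exact hi (Finset.mem_image.2 ⟨_, h, rfl⟩)

end diag

/-! ### Independent columns in the construction -/

theorem colsIndep_matM₀ {K : Type*} [Field K] {q δ n₂ : ℕ} {β : K}
    (hβ : IsPrimitiveRoot β (q - 1)) (hn₂ : n₂ < q) {T : Finset (Fin n₂)} (hT : T.card ≤ δ) :
    ColsIndep (matM₀ δ n₂ β) T := by
  intro c hc hker
  refine eq_zero_of_forall_sum_mul_pow_eq_zero
    (node := fun j : Fin n₂ => if (j : ℕ) = 0 then 0 else β ^ (j : ℕ)) ?_ hT hc fun l hl => ?_
  · refine Function.Injective.injOn fun i j hij => Fin.ext ?_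
    have hi := i.2
    have hj := j.2
    have hβ0 : β ≠ 0 := hβ.ne_zero (by omega)
    split_ifs at hij with h1 h2 h2
    · rw [h1, h2]
    · exact absurd hij.symm (pow_ne_zero _ hβ0)
    · exact absurd hij (pow_ne_zero _ hβ0)
    · exact hβ.pow_inj (by omega) (by omega) hij
  · have := congrFun hker ⟨l, hl⟩
    simpa [matM₀, mulVec, dotProduct, mul_comm] using this

theorem matH₀_eq {K₀ K₁ : Type*} [Field K₀] [Field K₁] [Algebra K₀ K₁] (q h₂ δ : ℕ) {t₂ n₂ : ℕ}
    (β : K₀) (α : Fin t₂ × Fin n₂ → K₁) :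
    matH₀ q h₂ δ β α = fromRows ((diagCopies (Fin t₂) (matM₀ δ n₂ β)).map (algebraMap K₀ K₁))
      (frobeniusRows q h₂ α) := by
  rw [matH₀]
  congr 1
  ext x y
  simp [diagCopies, apply_ite (algebraMap K₀ K₁)]

theorem matH_eq {K₀ K₁ K₂ : Type*} [Field K₀] [Field K₁] [Field K₂] [Algebra K₀ K₁]
    [Algebra K₁ K₂] (q m₁ h₁ h₂ δ : ℕ) {t₁ t₂ n₂ : ℕ} (β : K₀) (α : Fin t₂ × Fin n₂ → K₁)
    (lam : Coord t₁ t₂ n₂ → K₂) :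
    matH q m₁ h₁ h₂ δ β α lam
      = fromRows ((diagCopies (Fin t₁) (matH₀ q h₂ δ β α)).map (algebraMap K₁ K₂))
        (frobeniusRows (q ^ m₁) h₁ lam) := by
  rw [matH]
  congr 1
  ext x y
  simp [diagCopies, apply_ite (algebraMap K₁ K₂)]

/-- A set `T` of `t₂ δ + h₂` columns of `H₀` with at least `δ` columns in each local group is
independent, and a kernel vector supported on `T` and one further index has weight at
most `(δ + 1) (h₂ + 1)`. -/
theorem colsIndep_matH₀ {K₀ K₁ : Type*} [Field K₀] [Finite K₀] [Field K₁] [Algebra K₀ K₁]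
    {q h₂ δ t₂ n₂ : ℕ} (hK₀ : Nat.card K₀ = q) {β : K₀} (hβ : IsPrimitiveRoot β (q - 1))
    (hn₂ : n₂ < q) {α : Fin t₂ × Fin n₂ → K₁} (hα : WiseIndependent K₀ ((δ + 1) * h₂) α)
    {T : Finset (Fin t₂ × Fin n₂)} (hT : T.card = t₂ * δ + h₂)
    (hTs : ∀ s, δ ≤ (slice T s).card) :
    ColsIndep (matH₀ q h₂ δ β α) T ∧
      ∀ x, ∀ g : Fin t₂ × Fin n₂ → K₁, matH₀ q h₂ δ β α *ᵥ g = 0 →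
        (∀ y, y ∉ insert x T → g y = 0) →
        ∃ U : Finset (Fin t₂ × Fin n₂), U.card ≤ (δ + 1) * (h₂ + 1) ∧ ∀ y, y ∉ U → g y = 0 := by
  -- split `T` into `δ` columns `L` per local group and `h₂` remaining columns `R`
  choose L₀ hL₀ hL₀c using fun s => Finset.exists_subset_card_eq (hTs s)
  set L : Finset (Fin t₂ × Fin n₂) := Finset.univ.filter fun x => x.2 ∈ L₀ x.1 with hL
  have hslice : ∀ s, slice L s = L₀ s := fun s => by ext y; simp [mem_slice, hL]
  have hLT : L ⊆ T := fun x hx => mem_slice.1 (hL₀ x.1 (by simpa [hL] using hx))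
  have hLc : L.card = t₂ * δ := by
    rw [← sum_card_slice]
    simp [hslice, hL₀c]
  set R := T \ L with hR
  have hRc : R.card = h₂ := by
    rw [hR, Finset.card_sdiff_of_subset hLT]
    omega
  have hLR : L ∪ R = T := Finset.union_sdiff_of_subset hLT
  have hsl : ∀ s, (slice L s).card ≤ δ := fun s => by rw [hslice, hL₀c]
  have hM₀ : ∀ s, ColsIndep (matM₀ δ n₂ β) (slice L s) := fun s => colsIndep_matM₀ hβ hn₂ (hsl s)
  rw [matH₀_eq]
  constructor
  · rw [← hLR]
    refine ColsIndep.fromRows_frobeniusRows (u := δ + 1) hK₀ (ColsIndep.diagCopies hM₀) ?_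
      Finset.disjoint_sdiff hRc.le ?_ hα
    · simp [hLc]
    · intro s _ g hg hgs
      have := exists_small_support (R := {s}) hsl hM₀ hg (fun y hy => hgs y (by
        simpa [or_comm] using hy))
      simpa using this
  · intro x g hg hgx
    rw [fromRows_mulVec, map_diagCopies] at hg
    have hg1 : diagCopies (Fin t₂) ((matM₀ δ n₂ β).map (algebraMap K₀ K₁)) *ᵥ g = 0 :=
      funext fun i => congrFun hg (Sum.inl i)
    obtain ⟨U, hU, hUg⟩ := exists_small_support (R := insert x R) hsl (fun s => (hM₀ s).map K₁) hg1
      (fun y hy => hgx y (by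
        rw [← hLR]
        simp only [Finset.mem_union, Finset.mem_insert] at hy ⊢
        tauto))
    refine ⟨U, hU.trans (Nat.mul_le_mul_left _ ?_), hUg⟩
    exact (Finset.card_insert_le _ _).trans (by rw [hRc])

/-- Maximal recoverability from the independence of the parameters. -/
theorem isHLMRC_codeOf {k r₁ r₂ h₁ h₂ δ t₁ t₂ q m₁ : ℕ} (hk : 0 < k)
    (ht₁ : t₁ * r₁ = k + h₁) (ht₂ : t₂ * r₂ = r₁ + h₂)
    {K₀ K₁ K₂ : Type*} [Field K₀] [Finite K₀] [Field K₁] [Finite K₁] [Field K₂]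
    [Algebra K₀ K₁] [Algebra K₁ K₂] (hK₀ : Nat.card K₀ = q) (hK₁ : Nat.card K₁ = q ^ m₁)
    (hq : r₂ + δ < q) {β : K₀} (hβ : IsPrimitiveRoot β (q - 1))
    {α : Fin t₂ × Fin (r₂ + δ) → K₁} (hα : WiseIndependent K₀ ((δ + 1) * h₂) α)
    {lam : Coord t₁ t₂ (r₂ + δ) → K₂}
    (hlam : WiseIndependent K₁ ((δ + 1) * (h₂ + 1) * h₁) lam) :
    IsHLMRC k r₁ r₂ h₁ h₂ δ (codeOf q m₁ h₁ h₂ δ β α lam) := by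
  have hcard : Fintype.card ((Fin t₁ × ((Fin t₂ × Fin δ) ⊕ Fin h₂)) ⊕ Fin h₁) + k
      = Fintype.card (Coord t₁ t₂ (r₂ + δ)) := by
    rw [card_coord ht₁ ht₂]
    simp only [Fintype.card_sum, Fintype.card_prod, Fintype.card_fin]
    ring
  have key : ∀ E : Finset (Coord t₁ t₂ (r₂ + δ)), E.card = k + h₁ →
      (∀ i s, (E ∩ groupB i s).card ≤ r₂) → (∀ i, (E ∩ groupA i).card = r₁) →
      Module.finrank K₂ (codeOf q m₁ h₁ h₂ δ β α lam) = k ∧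
        IsMDS (k + h₁) k (restrictTo (codeOf q m₁ h₁ h₂ δ β α lam) E) := by
    intro E hE hB hA
    refine isMDS_restrictTo_ker hk hcard hE fun S hS hSc => ?_
    have hslice : ∀ i, (slice Eᶜ i).card = t₂ * δ + h₂ := by
      intro i
      have h1 : slice Eᶜ i = (slice E i)ᶜ := by ext y; simp [mem_slice]
      have h2 : (slice E i).card = r₁ := by
        rw [card_slice, ← hA i]
        congr 1
        ext x
        simp [groupA]
      rw [h1, Finset.card_compl, h2]
      simp only [Fintype.card_prod, Fintype.card_fin]
      rw [mul_add, ht₂]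
      omega
    have hslice₂ : ∀ i s, δ ≤ (slice (slice Eᶜ i) s).card := by
      intro i s
      have h1 : slice (slice Eᶜ i) s = (slice (slice E i) s)ᶜ := by ext y; simp [mem_slice]
      have h2 : (slice (slice E i) s).card ≤ r₂ := by
        refine le_trans (le_of_eq ?_) (hB i s)
        rw [← Finset.card_image_of_injective (slice (slice E i) s)
          (f := fun y => ((i, s, y) : Coord t₁ t₂ (r₂ + δ))) (fun y z h => by simpa using h)]
        congr 1
        ext ⟨i', s', y⟩
        simp only [Finset.mem_image, mem_slice, Finset.mem_inter, groupB, Finset.mem_filter,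
          Finset.mem_univ, true_and, Prod.mk.injEq]
        constructor
        · rintro ⟨y, hy, rfl, rfl, rfl⟩
          exact ⟨hy, rfl, rfl⟩
        · rintro ⟨hy, rfl, rfl⟩
          exact ⟨y, hy, rfl, rfl, rfl⟩
      rw [h1, Finset.card_compl, Fintype.card_fin]
      omega
    have hH₀ := fun i => colsIndep_matH₀ hK₀ hβ hq hα (hslice i) (hslice₂ i)
    rw [matH_eq]
    refine ColsIndep.fromRows_frobeniusRows (u := (δ + 1) * (h₂ + 1)) hK₁
      (ColsIndep.diagCopies fun i => (hH₀ i).1) ?_ ?_ hSc.le ?_ hlam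
    · rw [← sum_card_slice]
      simp [hslice]
    · exact Finset.disjoint_left.2 fun x hx hxS => Finset.mem_compl.1 hx (hS hxS)
    · rintro ⟨i, x⟩ _ g hg hgs
      -- off the middle group of the extra index, `g` is supported on independent columns
      have hoff : ∀ i' ≠ i, ∀ y, g (i', y) = 0 := by
        intro i' hi' y
        refine congrFun ((hH₀ i').1 (fun y => g (i', y)) (fun y hy => hgs _ ?_)
          (mulVec_slice_eq_zero hg i')) y
        simpa [hi', mem_slice] using hy
      obtain ⟨U, hU, hUg⟩ := (hH₀ i).2 x (fun y => g (i, y)) (mulVec_slice_eq_zero hg i)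
        (fun y hy => hgs _ (by simpa [mem_slice] using hy))
      refine ⟨U.image (Prod.mk i), Finset.card_image_le.trans hU, ?_⟩
      rintro ⟨i', y⟩ hy
      by_cases hi' : i' = i
      · subst hi'
        exact hUg y fun h => hy (Finset.mem_image_of_mem _ h)
      · exact hoff i' hi' y
  refine ⟨⟨ht₁, ht₂, ?_, ?_⟩, fun E hE hB hA => (key E hE hB hA).2⟩
  · -- the dimension is read off from any admissible `E`, and one exists as `r₁ ≤ t₂ r₂`
    obtain ⟨P, hP, hPc⟩ : ∃ P ⊆ (Finset.univ : Finset (Fin t₂ × Fin (r₂ + δ))).filter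
        (fun y => (y.2 : ℕ) < r₂), P.card = r₁ := by
      apply Finset.exists_subset_card_eq
      have : (Finset.univ : Finset (Fin t₂ × Fin (r₂ + δ))).filter (fun y => (y.2 : ℕ) < r₂)
          = Finset.univ ×ˢ Finset.univ.filter fun j : Fin (r₂ + δ) => (j : ℕ) < r₂ := by
        ext y; simp
      rw [this, Finset.card_product, Fin.card_filter_val_lt]
      simp only [Finset.card_univ, Fintype.card_fin]
      rw [min_eq_right (by omega), ht₂]
      omega
    refine (key (Finset.univ ×ˢ P) ?_ ?_ ?_).1
    · rw [Finset.card_product, Finset.card_univ, Fintype.card_fin, hPc, ht₁]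
    · intro i s
      have hsub : (Finset.univ ×ˢ P) ∩ groupB i s ⊆
          (Finset.univ.filter fun j : Fin (r₂ + δ) => (j : ℕ) < r₂).image
            fun j => ((i, s, j) : Coord t₁ t₂ (r₂ + δ)) := by
        rintro ⟨i', s', j⟩ hx
        simp only [Finset.mem_inter, Finset.mem_product, groupB, Finset.mem_filter,
          Finset.mem_univ, true_and] at hx
        obtain ⟨hx, rfl, rfl⟩ := hx
        have := hP hx
        simp only [Finset.mem_filter, Finset.mem_univ, true_and] at this
        simpa using this
      refine (Finset.card_le_card hsub).trans (Finset.card_image_le.trans ?_)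
      rw [Fin.card_filter_val_lt]
      exact min_le_right _ _
    · intro i
      have : (Finset.univ ×ˢ P) ∩ groupA i = P.image (Prod.mk i) := by
        ext ⟨i', y⟩
        simp only [Finset.mem_inter, Finset.mem_product, groupA, Finset.mem_filter,
          Finset.mem_univ, true_and, Finset.mem_image, Prod.mk.injEq]
        constructor
        · rintro ⟨hy, rfl⟩
          exact ⟨y, hy, rfl, rfl⟩
        · rintro ⟨y, hy, rfl, rfl⟩
          exact ⟨hy, rfl⟩
      rw [this, Finset.card_image_of_injective _ (Prod.mk_right_injective i), hPc]
  · refine ⟨fun l x => lam x ^ (q ^ m₁) ^ (l : ℕ),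
      fun _ l y => algebraMap K₁ K₂ (α y ^ q ^ (l : ℕ)),
      fun _ _ l j => algebraMap K₁ K₂ (algebraMap K₀ K₁ (matM₀ δ (r₂ + δ) β l j)), fun c => ?_⟩
    rw [codeOf, LinearMap.mem_ker, mulVecLin_apply, matH_eq, map_diagCopies, fromRows_mulVec]
    have hglob : ∀ l, (frobeniusRows (q ^ m₁) h₁ lam *ᵥ c) l
        = ∑ x, lam x ^ (q ^ m₁) ^ (l : ℕ) * c x := fun l => rfl
    have hmid : ∀ i l, ((matH₀ q h₂ δ β α).map (algebraMap K₁ K₂) *ᵥ fun y => c (i, y)) (Sum.inr l)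
        = ∑ y, algebraMap K₁ K₂ (α y ^ q ^ (l : ℕ)) * c (i, y) := fun i l => rfl
    have hloc : ∀ i s l,
        ((matH₀ q h₂ δ β α).map (algebraMap K₁ K₂) *ᵥ fun y => c (i, y)) (Sum.inl (s, l))
        = ∑ j, algebraMap K₁ K₂ (algebraMap K₀ K₁ (matM₀ δ (r₂ + δ) β l j)) * c (i, s, j) := by
      intro i s l
      rw [matH₀_eq, map_diagCopies]
      have : ∀ (A : Matrix (Fin t₂ × Fin δ) (Fin t₂ × Fin (r₂ + δ)) K₁)
          (B : Matrix (Fin h₂) (Fin t₂ × Fin (r₂ + δ)) K₁),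
          (fromRows A B).map (algebraMap K₁ K₂)
            = fromRows (A.map (algebraMap K₁ K₂)) (B.map (algebraMap K₁ K₂)) := by
        intro A B
        ext x y
        cases x <;> rfl
      rw [this, map_diagCopies, fromRows_mulVec]
      exact diagCopies_mulVec _ _ (s, l)
    rw [funext_iff, Sum.forall]
    simp only [Sum.elim_inl, Sum.elim_inr, Pi.zero_apply, diagCopies_mulVec, Prod.forall,
      Sum.forall, hglob, hmid, hloc]
    constructor
    · exact fun h => ⟨h.2, fun i l => (h.1 i).2 l, fun i s l => (h.1 i).1 s l⟩
    · exact fun h => ⟨fun i => ⟨fun s l => h.2.2 i s l, fun l => h.2.1 i l⟩, h.1⟩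

/-! ### BCH codes -/

/-- The BCH bound: `w` consecutive zeros give a Vandermonde system, so a word supported on at
most `w` positions is zero. -/
theorem AreBCHColumns.wiseIndependent {F L ι : Type*} [Field F] [Field L] [Algebra F L]
    {N w μ : ℕ} {a : ι → L} (h : AreBCHColumns F N (w + 1) μ a) : WiseIndependent F w a := by
  classical
  obtain ⟨C, ⟨γ, b, hγ, hC⟩, P, hP, e, pos, ha⟩ := h
  intro T hT
  rw [linearIndepOn_finset_iff]
  intro f hf
  set c : Fin N → F := ∑ x ∈ T, Pi.single (pos x) (f x) with hc
  have hcpos : ∀ x ∈ T, c (pos x) = f x := by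
    intro x hx
    rw [hc, Finset.sum_apply, Finset.sum_eq_single x]
    · simp
    · intro y _ hyx
      exact Pi.single_eq_of_ne (fun e => hyx (pos.injective e).symm) _
    · exact fun h => absurd hx h
  have hcout : ∀ j, j ∉ T.map pos → c j = 0 := by
    intro j hj
    rw [hc, Finset.sum_apply]
    refine Finset.sum_eq_zero fun x hx => Pi.single_eq_of_ne (fun e => hj ?_) _
    rw [e]
    exact Finset.mem_map_of_mem _ hx
  have hcC : c ∈ C := by
    rw [← hP, LinearMap.mem_ker, mulVecLin_apply, hc, mulVec_sum]
    apply e.injective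
    rw [map_sum, map_zero, ← hf]
    refine Finset.sum_congr rfl fun x _ => ?_
    rw [ha x, ← map_smul, mulVec_single, op_smul_eq_smul]
  intro x hx
  have hN : N ≠ 0 := fun h0 => (Fin.cast h0 (pos x)).elim0
  have hγ0 : γ ≠ 0 := hγ.ne_zero hN
  have hzero : (fun j : Fin N => algebraMap F (AlgebraicClosure F) (c j) * γ ^ (b * j)) = 0 := by
    refine eq_zero_of_forall_sum_mul_pow_eq_zero (node := fun j : Fin N => γ ^ (j : ℕ))
      (T := T.map pos) (d := w) ?_ (by rwa [Finset.card_map]) (fun j hj => ?_) fun i hi => ?_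
    · exact fun i _ j _ hij => Fin.ext (hγ.pow_inj i.2 j.2 hij)
    · rw [hcout j hj, map_zero, zero_mul]
    · rw [← (hC c).1 hcC i (by omega)]
      refine Finset.sum_congr rfl fun j _ => ?_
      rw [mul_assoc, ← pow_mul, ← pow_mul, ← pow_add]
      congr 2
      ring
  have := congrFun hzero (pos x)
  rw [hcpos x hx] at this
  simpa [hγ0] using this

/-- The elements fixed by `x ↦ x ^ Q ^ D` form a space of dimension at most `D` over a field with
`Q` elements. -/
theorem exists_submodule_pow_card {F : Type*} (K : Type*) [Field F] [Finite F] [Field K]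
    [Algebra F K] {Q D : ℕ} (hQ : Nat.card F = Q) (hD : D ≠ 0) :
    ∃ W : Submodule F K, (∀ x, x ∈ W ↔ x ^ Q ^ D = x) ∧ Module.Finite F W ∧
      Module.finrank F W ≤ D := by
  classical
  have hQ1 : 1 < Q := hQ ▸ Finite.one_lt_card
  obtain ⟨φ, hφ⟩ := exists_algHom_pow_card K hQ D
  let W : Submodule F K := LinearMap.ker (φ.toLinearMap - LinearMap.id)
  have hW : ∀ x, x ∈ W ↔ x ^ Q ^ D = x := fun x => by
    simp [W, LinearMap.mem_ker, sub_eq_zero, hφ]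
  set p : K[X] := X ^ Q ^ D - X with hp
  have hp0 : p ≠ 0 := FiniteField.X_pow_card_pow_sub_X_ne_zero K hD hQ1
  have hsub : (W : Set K) ⊆ p.roots.toFinset := by
    intro x hx
    rw [Finset.mem_coe, Multiset.mem_toFinset, mem_roots hp0]
    simp [hp, (hW x).1 hx]
  have hfin : Finite W := (Finset.finite_toSet _).subset hsub
  refine ⟨W, hW, inferInstance, ?_⟩
  have hcard : Nat.card W ≤ Q ^ D := by
    calc Nat.card W = (W : Set K).ncard := rfl
      _ ≤ (p.roots.toFinset : Set K).ncard := Set.ncard_le_ncard hsub (Finset.finite_toSet _)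
      _ = p.roots.toFinset.card := Set.ncard_coe_finset _
      _ ≤ p.roots.card := Multiset.toFinset_card_le _
      _ ≤ p.natDegree := p.card_roots'
      _ = Q ^ D := FiniteField.X_pow_card_pow_sub_X_natDegree_eq K hD hQ1
  rw [Module.natCard_eq_pow_finrank (K := F), hQ] at hcard
  exact (Nat.pow_le_pow_iff_right hQ1).1 hcard

/-- The number of `1 ≤ i ≤ n` not divisible by `Q` is at most `⌈(Q - 1) n / Q⌉`. -/
theorem card_not_dvd_le {Q : ℕ} (hQ : 0 < Q) (n : ℕ) :
    ((Finset.Ioc 0 n).filter fun i => ¬ Q ∣ i).card ≤ ⌈((Q : ℝ) - 1) / Q * n⌉₊ := by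
  have h1 := Finset.card_filter_add_card_filter_not (s := Finset.Ioc 0 n) (fun i => Q ∣ i)
  rw [Nat.Ioc_filter_dvd_card_eq_div, Nat.card_Ioc, Nat.sub_zero] at h1
  set A := ((Finset.Ioc 0 n).filter fun i => ¬ Q ∣ i).card
  by_contra! hlt
  have h2 : ((Q : ℝ) - 1) / Q * n ≤ ⌈((Q : ℝ) - 1) / Q * n⌉₊ := Nat.le_ceil _
  have h3 : ((⌈((Q : ℝ) - 1) / Q * n⌉₊ : ℕ) : ℝ) + 1 ≤ A := by exact_mod_cast hlt
  have hQr : (0 : ℝ) < Q := by exact_mod_cast hQ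
  have h4 : ((Q : ℝ) - 1) * n ≤ Q * (A - 1) := by
    have : ((Q : ℝ) - 1) / Q * n ≤ A - 1 := by linarith
    rw [div_mul_eq_mul_div, div_le_iff₀ hQr] at this
    linarith
  have h5 : (Q : ℝ) * (n / Q : ℕ) + (n % Q : ℕ) = n := by exact_mod_cast Nat.div_add_mod n Q
  have h6 : ((n % Q : ℕ) : ℝ) < Q := by exact_mod_cast Nat.mod_lt n hQ
  have h7 : ((n / Q : ℕ) : ℝ) + A = n := by exact_mod_cast h1
  have h8 : (A : ℝ) = n - (n / Q : ℕ) := by linarith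
  rw [h8] at h4
  linarith

/-- A primitive BCH code with `b = 0` has redundancy at most
`1 + ⌈(Q - 1) (d - 2) / Q⌉ D`. The zero `γ ^ 0` costs one equation, the zeros `γ ^ i` with `Q ∣ i`
are implied by `γ ^ (i / Q)` through Frobenius, and each of the others costs at most `D`
equations since `γ ^ i` lies in the field with `Q ^ D` elements. -/
theorem exists_areBCHColumns {F L ι : Type*} [Field F] [Finite F] [Field L] [Algebra F L]
    [Fintype ι] {Q D d μ : ℕ} (hQ : Nat.card F = Q) (hD : D ≠ 0)
    (hι : Fintype.card ι ≤ Q ^ D - 1) (hL : Module.finrank F L = μ)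
    (hμ : 1 + ⌈((Q : ℝ) - 1) / Q * ((d : ℝ) - 2)⌉₊ * D ≤ μ) :
    ∃ a : ι → L, AreBCHColumns F (Q ^ D - 1) d μ a := by
  classical
  have hQ1 : 1 < Q := hQ ▸ Finite.one_lt_card
  have hQD : 1 < Q ^ D := Nat.one_lt_pow hD hQ1
  set N := Q ^ D - 1 with hN
  have hNF : (N : F) ≠ 0 := by
    have := Fintype.ofFinite F
    have h0 : (Q : F) = 0 := by
      rw [← hQ, Nat.card_eq_fintype_card]
      exact Nat.cast_card_eq_zero F
    rw [hN, Nat.cast_sub hQD.le, Nat.cast_pow, h0, zero_pow hD]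
    simp
  have : NeZero (N : F) := ⟨hNF⟩
  obtain ⟨γ, hγ⟩ := HasEnoughRootsOfUnity.exists_primitiveRoot (AlgebraicClosure F) N
  -- evaluation of words at `γ ^ i`
  let ev : ℕ → (Fin N → F) →ₗ[F] AlgebraicClosure F := fun i =>
    Fintype.linearCombination F fun j : Fin N => (γ ^ i) ^ (j : ℕ)
  have hev : ∀ i c, ev i c
      = ∑ j : Fin N, algebraMap F (AlgebraicClosure F) (c j) * (γ ^ i) ^ (j : ℕ) := by
    intro i c
    simp [ev, Fintype.linearCombination_apply, Algebra.smul_def]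
  have hevpow : ∀ l i c, ev i c ^ Q ^ l = ev (i * Q ^ l) c := by
    intro l i c
    obtain ⟨φ, hφ⟩ := exists_algHom_pow_card (AlgebraicClosure F) hQ l
    rw [← hφ, hev, hev, map_sum]
    refine Finset.sum_congr rfl fun j _ => ?_
    rw [map_mul, AlgHom.commutes, map_pow, hφ, ← pow_mul γ]
  let C : Submodule F (Fin N → F) := ⨅ i : ℕ, ⨅ _ : i + 1 < d, LinearMap.ker (ev i)
  have hC : ∀ c, c ∈ C ↔ ∀ i : ℕ, i + 1 < d → ev i c = 0 := by
    intro c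
    simp [C, Submodule.mem_iInf]
  suffices hP : ∃ f : (Fin N → F) →ₗ[F] (Fin μ → F), LinearMap.ker f = C by
    obtain ⟨f, hf⟩ := hP
    have hpos : 0 < Module.finrank F L := by omega
    have : Module.Finite F L := Module.finite_of_finrank_pos hpos
    obtain ⟨pos⟩ : Nonempty (ι ↪ Fin N) :=
      Function.Embedding.nonempty_of_card_le (by rwa [Fintype.card_fin])
    have e : (Fin μ → F) ≃ₗ[F] L := LinearEquiv.ofFinrankEq _ _ (by simp [hL])
    refine ⟨fun x => e ((LinearMap.toMatrix' f).col (pos x)), C, ⟨γ, 0, hγ, fun c => ?_⟩,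
      LinearMap.toMatrix' f, ?_, e, pos, fun _ => rfl⟩
    · rw [hC]
      simp only [hev, zero_add]
    · rw [← hf, ← Matrix.toLin'_apply', Matrix.toLin'_toMatrix']
  -- for `d ≤ 1` there are no equations; this must be separated because `d - 2` truncates
  rcases Nat.lt_or_ge d 2 with hd | hd
  · refine ⟨0, ?_⟩
    rw [LinearMap.ker_zero, eq_comm, eq_top_iff]
    exact fun c _ => (hC c).2 fun i hi => by omega
  obtain ⟨W, hW, hWfin, hWD⟩ := exists_submodule_pow_card (AlgebraicClosure F) hQ hD
  have hγQ : γ ^ Q ^ D = γ := by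
    rw [show Q ^ D = N + 1 by omega, pow_succ, hγ.pow_eq_one, one_mul]
  have hevW : ∀ i c, ev i c ∈ W := by
    intro i c
    rw [hW, hevpow, hev, hev]
    refine Finset.sum_congr rfl fun j _ => ?_
    rw [mul_comm i, pow_mul γ (Q ^ D) i, hγQ]
  set I := (Finset.Ioc 0 (d - 2)).filter fun i => ¬ Q ∣ i with hI
  let Φ : (Fin N → F) →ₗ[F] F × (I → W) :=
    (∑ j, LinearMap.proj j).prod (LinearMap.pi fun i => (ev i).codRestrict W (hevW i))
  have hΦ : LinearMap.ker Φ = C := by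
    ext c
    have hmem : c ∈ LinearMap.ker Φ ↔ ∑ j, c j = 0 ∧ ∀ i ∈ I, ev i c = 0 := by
      simp [Φ, LinearMap.ker_prod, funext_iff, Subtype.ext_iff]
    rw [hmem, hC]
    have hev0 : ev 0 c = algebraMap F (AlgebraicClosure F) (∑ j, c j) := by
      rw [hev, map_sum]
      simp
    constructor
    · rintro ⟨h0, hi⟩ i
      induction i using Nat.strong_induction_on with
      | _ i ih =>
        intro hid
        rcases Nat.eq_zero_or_pos i with rfl | hi0
        · rw [hev0, h0, map_zero]
        by_cases hdvd : Q ∣ i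
        · obtain ⟨i', rfl⟩ := hdvd
          have hi' : 0 < i' := Nat.pos_of_mul_pos_left hi0
          have hlt : i' < Q * i' := by nlinarith
          have := hevpow 1 i' c
          rw [pow_one, ih i' hlt (by omega), zero_pow (by omega), mul_comm] at this
          exact this.symm
        · exact hi i (by rw [hI, Finset.mem_filter, Finset.mem_Ioc]; exact ⟨⟨hi0, by omega⟩, hdvd⟩)
    · intro h
      refine ⟨?_, fun i hi => h i ?_⟩
      · have := h 0 (by omega)
        rw [hev0] at this
        exact (map_eq_zero _).1 this
      · rw [hI, Finset.mem_filter, Finset.mem_Ioc] at hi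
        omega
  have hrank : Module.finrank F (F × (I → W)) ≤ Module.finrank F (Fin μ → F) := by
    rw [Module.finrank_prod, Module.finrank_self, Module.finrank_pi_fintype,
      Module.finrank_fintype_fun_eq_card, Fintype.card_fin]
    refine le_trans ?_ hμ
    simp only [Finset.sum_const, Finset.card_univ, Fintype.card_coe, smul_eq_mul]
    have hc := card_not_dvd_le (Q := Q) (by omega) (d - 2)
    rw [Nat.cast_sub hd, Nat.cast_ofNat] at hc
    exact Nat.add_le_add_left (Nat.mul_le_mul hc hWD) 1
  obtain ⟨ψ, hψ⟩ := finrank_le_iff_exists_linearMap.1 hrank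
  refine ⟨ψ ∘ₗ Φ, ?_⟩
  rw [LinearMap.ker_comp, LinearMap.ker_eq_bot.2 hψ, Submodule.comap_bot, hΦ]

theorem le_pow_bchDegree {Q n : ℕ} (hQ : 1 < Q) (hn : 0 < n) : n ≤ Q ^ bchDegree Q n := by
  have h1 : Real.logb Q n ≤ (bchDegree Q n : ℝ) := Nat.le_ceil _
  rw [Real.logb_le_iff_le_rpow (by exact_mod_cast hQ) (by exact_mod_cast hn),
    Real.rpow_natCast] at h1
  exact_mod_cast h1

/-- If `q` is the least prime power above `n₂ ≥ 2`, then `n₂` divides no power of `q`: otherwise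
`q` and `n₂` are powers of the same prime `p`, so `q ≥ p n₂ ≥ 2 n₂`, while by Bertrand's
postulate there is a prime `n₂ < r ≤ 2 n₂`, which forces `q = 2 n₂` to be prime. -/
theorem not_dvd_pow_of_isLeast {q n₂ : ℕ} (hn₂ : 2 ≤ n₂)
    (hq : IsLeast {p : ℕ | IsPrimePow p ∧ n₂ < p} q) (M : ℕ) : ¬ n₂ ∣ q ^ M := by
  intro hdvd
  obtain ⟨⟨hpp, hlt⟩, hleast⟩ := hq
  obtain ⟨p, e, hp, he, rfl⟩ := (isPrimePow_nat_iff q).1 hpp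
  rw [← pow_mul] at hdvd
  obtain ⟨f, -, rfl⟩ := (Nat.dvd_prime_pow hp).1 hdvd
  obtain ⟨r, hr, hr1, hr2⟩ := Nat.exists_prime_lt_and_le_two_mul (p ^ f) (by omega)
  have hqr : p ^ e ≤ r := hleast ⟨hr.isPrimePow, hr1⟩
  have hfe : f < e := (Nat.pow_lt_pow_iff_right hp.one_lt).1 hlt
  have h1 : p ^ (f + 1) ≤ p ^ e := Nat.pow_le_pow_right hp.pos hfe
  have h2 : 2 * p ^ f ≤ p ^ (f + 1) := by
    rw [pow_succ, mul_comm]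
    exact Nat.mul_le_mul_left _ hp.two_le
  have hr3 : r = 2 * p ^ f := by omega
  rw [hr3] at hr
  exact Nat.not_prime_mul (by omega) (by omega) hr

/-- The primitive BCH lengths of the construction are large enough. -/
theorem le_pow_bchDegree_sub_one {q n₂ a e : ℕ} (hn₂ : 2 ≤ n₂)
    (hq : IsLeast {p : ℕ | IsPrimePow p ∧ n₂ < p} q) (he : e ≠ 0) (ha : 0 < a) :
    bchDegree (q ^ e) (n₂ * a) ≠ 0 ∧ n₂ * a ≤ (q ^ e) ^ bchDegree (q ^ e) (n₂ * a) - 1 := by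
  have hq1 : 1 < q := hq.1.1.one_lt
  have hle := le_pow_bchDegree (Nat.one_lt_pow he hq1) (Nat.mul_pos (by omega : 0 < n₂) ha)
  have hna : n₂ ≤ n₂ * a := Nat.le_mul_of_pos_right _ ha
  refine ⟨fun h0 => ?_, ?_⟩
  · rw [h0, pow_zero] at hle
    omega
  · refine Nat.le_sub_one_of_lt (lt_of_le_of_ne hle fun h => ?_)
    rw [← pow_mul] at h
    exact not_dvd_pow_of_isLeast hn₂ hq _ (h ▸ Dvd.intro a rfl)

theorem finrank_eq_of_card {F L : Type*} [Field F] [Field L] [Algebra F L] {Q n : ℕ} (hQ : 1 < Q)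
    (hF : Nat.card F = Q) (hL : Nat.card L = Q ^ n) : Module.finrank F L = n := by
  have : Finite L := Nat.finite_of_card_ne_zero (by rw [hL]; exact pow_ne_zero _ (by omega))
  have h := Module.natCard_eq_pow_finrank (K := F) (V := L)
  rw [hL, hF] at h
  exact (Nat.pow_right_injective hQ h).symm

end HLMRC

theorem mainTheorem1 (k r₁ r₂ h₁ h₂ δ t₁ t₂ : ℕ) (hk : 0 < k) (hn₂ : 2 ≤ r₂ + δ)
    (ht₁ : t₁ * r₁ = k + h₁) (ht₂ : t₂ * r₂ = r₁ + h₂)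
    (q : ℕ) (hq : IsLeast {p : ℕ | IsPrimePow p ∧ r₂ + δ < p} q)
    (m₁ : ℕ) (hm₁ : m₁ = HLMRC.bchRedundancy q ((δ + 1) * h₂ + 1) ((r₂ + δ) * t₂))
    (m : ℕ) (hdvd : m₁ ∣ m)
    (hm : HLMRC.bchRedundancy (q ^ m₁) ((δ + 1) * (h₂ + 1) * h₁ + 1) (t₁ * t₂ * (r₂ + δ))
      ≤ m / m₁)
    (K₀ K₁ K₂ : Type*) [Field K₀] [Field K₁] [Field K₂] [Algebra K₀ K₁] [Algebra K₁ K₂]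
    (hK₀ : Nat.card K₀ = q) (hK₁ : Nat.card K₁ = q ^ m₁) (hK₂ : Nat.card K₂ = q ^ m) :
    (∃ (β : K₀) (α : Fin t₂ × Fin (r₂ + δ) → K₁) (lam : HLMRC.Coord t₁ t₂ (r₂ + δ) → K₂),
      HLMRC.IsBCHChoice q m₁ m h₁ h₂ δ β α lam) ∧
    ∀ (β : K₀) (α : Fin t₂ × Fin (r₂ + δ) → K₁) (lam : HLMRC.Coord t₁ t₂ (r₂ + δ) → K₂),
      HLMRC.IsBCHChoice q m₁ m h₁ h₂ δ β α lam →
        HLMRC.WiseIndependent K₀ ((δ + 1) * h₂) α ∧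
        HLMRC.WiseIndependent K₁ ((δ + 1) * (h₂ + 1) * h₁) lam ∧
        HLMRC.IsHLMRC k r₁ r₂ h₁ h₂ δ (HLMRC.codeOf q m₁ h₁ h₂ δ β α lam) := by
  have hq1 : 1 < q := hq.1.1.one_lt
  have hm₁0 : m₁ ≠ 0 := by
    rw [hm₁, HLMRC.bchRedundancy]
    omega
  have hQ1 : 1 < q ^ m₁ := Nat.one_lt_pow hm₁0 hq1
  have : Finite K₀ := Nat.finite_of_card_ne_zero (by omega)
  have : Finite K₁ := Nat.finite_of_card_ne_zero (by omega)
  refine ⟨?_, fun β α lam ⟨hβ, hα, hlam⟩ => ?_⟩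
  swap
  · exact ⟨hα.wiseIndependent, hlam.wiseIndependent, HLMRC.isHLMRC_codeOf hk ht₁ ht₂ hK₀ hK₁
      hq.1.2 hβ hα.wiseIndependent hlam.wiseIndependent⟩
  have ht₁0 : 0 < t₁ := Nat.pos_of_ne_zero (by rintro rfl; omega)
  have hr₁0 : 0 < r₁ := Nat.pos_of_ne_zero (by rintro rfl; omega)
  have ht₂0 : 0 < t₂ := Nat.pos_of_ne_zero (by rintro rfl; omega)
  obtain ⟨β, hβ⟩ : ∃ β : K₀, IsPrimitiveRoot β (q - 1) := by
    obtain ⟨g, hg⟩ := IsCyclic.exists_generator (α := K₀ˣ)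
    refine ⟨g, IsPrimitiveRoot.coe_units_iff.2 ?_⟩
    rw [← hK₀, ← Nat.card_units, ← orderOf_eq_card_of_forall_mem_zpowers hg]
    exact IsPrimitiveRoot.orderOf g
  obtain ⟨hD, hlen⟩ := HLMRC.le_pow_bchDegree_sub_one hn₂ hq one_ne_zero ht₂0
  obtain ⟨hD', hlen'⟩ := HLMRC.le_pow_bchDegree_sub_one hn₂ hq hm₁0 (Nat.mul_pos ht₁0 ht₂0)
  rw [pow_one] at hD hlen
  rw [mul_comm (r₂ + δ) (t₁ * t₂)] at hD' hlen'
  have hK₂' : Nat.card K₂ = (q ^ m₁) ^ (m / m₁) := by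
    rw [hK₂, ← pow_mul, Nat.mul_div_cancel' hdvd]
  obtain ⟨α, hα⟩ := HLMRC.exists_areBCHColumns (F := K₀) (L := K₁) (ι := Fin t₂ × Fin (r₂ + δ))
    (d := (δ + 1) * h₂ + 1) hK₀ hD (by simpa [mul_comm] using hlen)
    (HLMRC.finrank_eq_of_card hq1 hK₀ hK₁) hm₁.ge
  obtain ⟨lam, hlam⟩ := HLMRC.exists_areBCHColumns (F := K₁) (L := K₂)
    (ι := HLMRC.Coord t₁ t₂ (r₂ + δ)) (d := (δ + 1) * (h₂ + 1) * h₁ + 1) hK₁ hD'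
    (by simpa [mul_assoc] using hlen') (HLMRC.finrank_eq_of_card hQ1 hK₁ hK₂') hm
  exact ⟨β, α, lam, hβ, hα, hlam⟩
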